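/- **Setting.** For every $m\ge 1$ let $n=n(m)=n_1+n_2$ and let $X_{i,j}$ ($1\le i\le m$, $1\le j\le n$) be independent with $X_{i,j}\sim N(\mu_i,1)$; the means $\mu_i=\mu_i^{(m)}$ may depend on $m$, except that $\mu_1\in\mathbb R$ is a constant. Hypothesis $H_i$ states that $\mu_i=0$. Let $T^{(1)}_{n,i}$ and $T^{(2)}_{n,i}$ be the one-sample $t$-statistics $\sqrt{n_k}\,\overline X/\hat\sigma$ (with sample mean $\overline X$ and unbiased sample variance $\hat\sigma^2$ of the respective subsample) computed from the first $n_1$ and from the remaining $n_2$ observations of the $i$-th sample, and let $t_\nu(p)$ be the $p$-quantile of Student's $t$-distribution with $\nu$ degrees of freedom. Fix $0<\alpha<1$ and $0<\gamma\le 1$. The split-sample method selects the set $$\hat S_n=\{i:\ |T^{(1)}_{n,i}|>t_{n_1-1}(1-m^{\gamma-1}/2)\}$$ and rejects $H_i$ if and only if $i\in\hat S_n$ and $|T^{(2)}_{n,i}|>t_{n_2-1}\bigl(1-\tfrac{\alpha}{2|\hat S_n|}\bigr)$. **Theorem 7.2.** Assume that, as $m\to\infty$, $\frac{\log m}{n}\to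 d$ with $0\le d<\infty$, that $n_1/n\to r$ with $0<r<1$, and that the number of false null hypotheses satisfies the sparsity condition $|\{i\le m:\mu_i\ne 0\}|\asymp m^{1-\epsilon}$ for some $0<\epsilon\le 1$. (i) If $\mu_1^2>\max\left[\exp\left(\frac{2(1-\gamma)d}{r}\right),\exp\left(\frac{2\gamma d}{1-r}\right)\right]-1$ and, in case $d>0$, also $\epsilon+\gamma\ge 1$, then $\lim_{m\to\infty}P\{H_1\text{ rejected}\}=1$. (ii) If $\mu_1^2<\max\left[\exp\left(\frac{2(1-\gamma)d}{r}\right),\exp\left(\frac{2\gamma d}{1-r}\right)\right]-1$, then $\lim_{m\to\infty}P\{H_1\text{ rejected}\}=0$. -/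

import Mathlib

open MeasureTheory ProbabilityTheory Filter Topology Asymptotics

namespace SplitSample

noncomputable section

/-- Chi-squared distribution with `k` degrees of freedom: the law of the sum of the squares of
`k` independent standard normal variables. -/
def chiSquared (k : ℕ) : Measure ℝ :=
  (Measure.pi fun _ : Fin k => gaussianReal 0 1).map fun z => ∑ j, z j ^ 2

/-- Student's `t`-distribution with `k ≥ 1` degrees of freedom: the law of `Z / √(V / k)`, where
`Z` is standard normal and `V` is an independent chi-squared variable with `k` degrees of
freedom. -/
def studentT (k : ℕ) : Measure ℝ :=
  ((gaussianReal 0 1).prod (chiSquared k)).map fun p => p.1 / √(p.2 / k)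

/-- The `p`-quantile `t_k(p)` of the `t`-distribution with `k` degrees of freedom (`0 < p < 1`). -/
def tQuantile (k : ℕ) (p : ℝ) : ℝ :=
  sInf {x : ℝ | p ≤ (studentT k).real (Set.Iic x)}

/-- Sample mean. -/
def sampleMean {k : ℕ} (x : Fin k → ℝ) : ℝ := (∑ j, x j) / k

/-- Unbiased sample variance (for `k ≥ 2`). -/
def sampleVar {k : ℕ} (x : Fin k → ℝ) : ℝ := (∑ j, (x j - sampleMean x) ^ 2) / ((k : ℝ) - 1)

/-- One-sample `t`-statistic for testing that the mean is zero. -/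
def tStat {k : ℕ} (x : Fin k → ℝ) : ℝ := √(k : ℝ) * sampleMean x / √(sampleVar x)

/-- The law `P_μ` of the data `(X i j)`: all entries are independent, and `X i j ∼ N(μ i, 1)`,
for `m` populations with `n` observations each. -/
def dataLaw {m : ℕ} (n : ℕ) (μ : Fin m → ℝ) : Measure (Fin m → Fin n → ℝ) :=
  Measure.pi fun i => Measure.pi fun _ : Fin n => gaussianReal (μ i) 1

/-- `t`-statistic for hypothesis `i` on the first `n₁` observations. -/
def tStat₁ {m n₁ n₂ : ℕ} (x : Fin m → Fin (n₁ + n₂) → ℝ) (i : Fin m) : ℝ :=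
  tStat fun j : Fin n₁ => x i (Fin.castAdd n₂ j)

/-- `t`-statistic for hypothesis `i` on the remaining `n₂` observations. -/
def tStat₂ {m n₁ n₂ : ℕ} (x : Fin m → Fin (n₁ + n₂) → ℝ) (i : Fin m) : ℝ :=
  tStat fun j : Fin n₂ => x i (Fin.natAdd n₁ j)

open Classical in
/-- The hypotheses selected in the first stage: those with
`|T⁽¹⁾ i| > t_{n₁ - 1}(1 - m ^ (γ - 1) / 2)`. -/
def selected {m n₁ n₂ : ℕ} (γ : ℝ) (x : Fin m → Fin (n₁ + n₂) → ℝ) : Finset (Fin m) :=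
  {i | tQuantile (n₁ - 1) (1 - (m : ℝ) ^ (γ - 1) / 2) < |tStat₁ x i|}

open Classical in
/-- The hypotheses rejected by the split-sample method at level `α`: the selected ones with
`|T⁽²⁾ i| > t_{n₂ - 1}(1 - α / (2 |Ŝ|))`, where `Ŝ` is the set of selected hypotheses
(which is nonempty as soon as the condition on `Ŝ` matters). -/
def rejected {m n₁ n₂ : ℕ} (α γ : ℝ) (x : Fin m → Fin (n₁ + n₂) → ℝ) : Finset (Fin m) :=
  {i ∈ selected γ x |
    tQuantile (n₂ - 1) (1 - α / (2 * ((selected γ x).card : ℝ))) < |tStat₂ x i|}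

/-- Probability, when the means are `μ`, that the split-sample method rejects the first of the `m`
hypotheses. -/
def rejectionProb {m : ℕ} (α γ : ℝ) (n₁ n₂ : ℕ) (μ : Fin m → ℝ) : ℝ :=
  (dataLaw (n₁ + n₂) μ).real {x | ∃ hm : 0 < m, (⟨0, hm⟩ : Fin m) ∈ rejected α γ x}

/-- Number of false null hypotheses `H i : μ i = 0`. -/
def numFalse {m : ℕ} (μ : Fin m → ℝ) : ℕ := Nat.card {i : Fin m // μ i ≠ 0}

end

end SplitSample

namespace SplitSample

/-! ### Tails of the normal, chi-squared and Student distributions -/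

/-! Everything is compared on the scale √k, with k the degrees of freedom. Conditioning on the
chi-squared denominator and using its Laplace transform gives P(T > √k y) = exp(-(k/2) log(1 + y²))
to exponential order (`studentT_real_Ioi_le`, `exists_le_studentT_real_Ioi`). Hence, if log m / k →
ℓ, the quantile with tail probability of order m^(-θ) is about √k · √(exp(2θℓ) - 1), while a
t-statistic with mean μ₁ concentrates at √k |μ₁| (`tendsto_real_tStat_gt`, `tendsto_real_tStat_le`).

In stage one θ = 1 - γ and ℓ = d/r. In stage two the level depends on |Ŝ|. True nulls contribute
about m^γ selections and false ones at most O(m^(1-ε)), so |Ŝ| exceeds m^θ for each θ < γ, and stays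
below m^θ for each θ > max(γ, 1 - ε), with probability tending to one. Thus the stage-two exponent
is γ with ℓ = d/(1 - r), and the two stages produce the two terms of the maximum.

Replacing |Ŝ| by a deterministic power of m reduces the rejection probability to union bounds, so
independence of the two stages is never needed. -/

lemma gaussianReal_real_Ioi_le {t : ℝ} (ht : 0 ≤ t) :
    (gaussianReal 0 1).real (Set.Ioi t) ≤ Real.exp (-t ^ 2 / 2) := by
  have h := measure_ge_le_exp_mul_mgf (μ := gaussianReal 0 1) (X := fun x => x) t ht
    (by simpa using integrable_exp_mul_gaussianReal (μ := 0) (v := 1) t)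
  have h2 : mgf (fun x => x) (gaussianReal 0 1) t = Real.exp (t ^ 2 / 2) := by
    have := congrFun (mgf_fun_id_gaussianReal (μ := 0) (v := 1)) t
    simpa using this
  rw [h2, ← Real.exp_add] at h
  refine (measureReal_mono (fun x hx => (le_of_lt hx : t ≤ x))).trans (h.trans_eq ?_)
  congr 1
  ring

/-- On (t, t + 1] one has x² ≤ t² + 2t + 1, and the cross term 2t is absorbed into ηt² + 1/η. Giving
up the factor 1 + η leaves a pure Gaussian exponential, which can be integrated against a
chi-squared law. -/
lemma exists_le_gaussianReal_real_Ioi {η : ℝ} (hη : 0 < η) :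
    ∃ c : ℝ, 0 < c ∧ ∀ t : ℝ, 0 ≤ t →
      c * Real.exp (-((1 + η) * t ^ 2 / 2)) ≤ (gaussianReal 0 1).real (Set.Ioi t) := by
  refine ⟨(√(2 * Real.pi))⁻¹ * Real.exp (-((1 + 1 / η) / 2)), by positivity, fun t ht => ?_⟩
  have hsub : Set.Ioc t (t + 1) ⊆ Set.Ioi t := fun x hx => hx.1
  refine le_trans ?_ (measureReal_mono hsub)
  rw [measureReal_def, gaussianReal_apply_eq_integral 0 one_ne_zero,
    ENNReal.toReal_ofReal (integral_nonneg fun x => gaussianPDFReal_nonneg 0 1 x)]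
  have hle : ∀ x ∈ Set.Ioc t (t + 1), (√(2 * Real.pi))⁻¹ * Real.exp (-((1 + 1 / η) / 2)) *
      Real.exp (-((1 + η) * t ^ 2 / 2)) ≤ gaussianPDFReal 0 1 x := by
    intro x hx
    rw [gaussianPDFReal_def, mul_assoc, ← Real.exp_add]
    simp only [NNReal.coe_one, mul_one, sub_zero]
    gcongr
    have h1 : x ^ 2 ≤ (t + 1) ^ 2 := pow_le_pow_left₀ (ht.trans hx.1.le) hx.2 2
    have h2 : 2 * t ≤ η * t ^ 2 + 1 / η := by
      have : η * t ^ 2 + 1 / η - 2 * t = (η * t - 1) ^ 2 / η := by field_simp; ring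
      have h3 : 0 ≤ (η * t - 1) ^ 2 / η := by positivity
      linarith
    nlinarith
  have := setIntegral_mono_on (μ := volume) (f := fun _ : ℝ => (√(2 * Real.pi))⁻¹ *
      Real.exp (-((1 + 1 / η) / 2)) * Real.exp (-((1 + η) * t ^ 2 / 2)))
    (integrableOn_const measure_Ioc_lt_top.ne) (integrable_gaussianPDFReal 0 1).integrableOn measurableSet_Ioc hle
  simpa using this

lemma integral_exp_neg_mul_sq_gaussianReal {s : ℝ} (hs : 0 ≤ s) :
    ∫ z, Real.exp (-s * z ^ 2) ∂gaussianReal 0 1 = Real.exp (-(1 / 2 * Real.log (1 + 2 * s))) := by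
  rw [integral_gaussianReal_eq_integral_smul one_ne_zero]
  have h : ∀ x : ℝ, gaussianPDFReal 0 1 x • Real.exp (-s * x ^ 2) =
      (√(2 * Real.pi))⁻¹ * Real.exp (-(s + 1 / 2) * x ^ 2) := by
    intro x
    simp only [gaussianPDFReal_def, smul_eq_mul, NNReal.coe_one, mul_one, sub_zero]
    rw [mul_assoc, ← Real.exp_add]
    congr 2
    ring
  simp_rw [h]
  have h1 : Real.exp (1 / 2 * Real.log (1 + 2 * s)) = √(1 + 2 * s) := by
    rw [Real.sqrt_eq_rpow, Real.rpow_def_of_pos (by positivity), mul_comm]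
  rw [integral_const_mul, integral_gaussian, Real.exp_neg, h1, ← Real.sqrt_inv, ← Real.sqrt_inv,
    ← Real.sqrt_mul (by positivity)]
  congr 1
  have := Real.pi_pos
  field_simp
  ring

@[fun_prop]
lemma measurable_sum_sq (k : ℕ) : Measurable fun z : Fin k → ℝ => ∑ j, z j ^ 2 := by
  fun_prop

instance isProbabilityMeasure_chiSquared (k : ℕ) : IsProbabilityMeasure (chiSquared k) :=
  Measure.isProbabilityMeasure_map (measurable_sum_sq k).aemeasurable

instance isProbabilityMeasure_studentT (k : ℕ) : IsProbabilityMeasure (studentT k) :=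
  Measure.isProbabilityMeasure_map (Measurable.aemeasurable (by fun_prop))

lemma ae_pos_chiSquared {k : ℕ} (hk : 0 < k) : ∀ᵐ v ∂chiSquared k, 0 < v := by
  rw [chiSquared, ae_map_iff (measurable_sum_sq k).aemeasurable measurableSet_Ioi]
  have h0 : ∀ᵐ x ∂gaussianReal 0 1, x ≠ 0 := by
    have := nullSingletonClass_gaussianReal (μ := 0) (v := 1) one_ne_zero
    rw [ae_iff]
    simp
  have h := (measurePreserving_eval (fun _ : Fin k => gaussianReal 0 1) ⟨0, hk⟩).quasiMeasurePreserving.ae h0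
  filter_upwards [h] with z hz
  have h1 : 0 < z ⟨0, hk⟩ ^ 2 := by
    have : z ⟨0, hk⟩ ≠ 0 := hz
    positivity
  exact h1.trans_le (Finset.single_le_sum (f := fun j => z j ^ 2) (fun j _ => sq_nonneg _)
    (Finset.mem_univ _))

lemma integral_exp_neg_mul_chiSquared (k : ℕ) {s : ℝ} (hs : 0 ≤ s) :
    ∫ v, Real.exp (-s * v) ∂chiSquared k = Real.exp (-(k / 2 * Real.log (1 + 2 * s))) := by
  rw [chiSquared, integral_map (measurable_sum_sq k).aemeasurable (by fun_prop)]
  simp_rw [Finset.mul_sum, Real.exp_sum]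
  rw [integral_fintype_prod_eq_pow (μ := gaussianReal 0 1)
    (f := fun z : ℝ => Real.exp (-s * z ^ 2)), integral_exp_neg_mul_sq_gaussianReal hs,
    ← Real.exp_nat_mul]
  simp only [Fintype.card_fin]
  congr 1
  ring

lemma integrable_exp_neg_mul_chiSquared {k : ℕ} (hk : 0 < k) {s : ℝ} (hs : 0 ≤ s) :
    Integrable (fun v => Real.exp (-s * v)) (chiSquared k) := by
  refine Integrable.mono' (integrable_const 1) (by fun_prop) ?_
  filter_upwards [ae_pos_chiSquared hk] with v hv
  rw [Real.norm_eq_abs, Real.abs_exp, Real.exp_le_one_iff]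
  nlinarith

lemma studentT_apply (k : ℕ) {s : Set ℝ} (hs : MeasurableSet s) :
    studentT k s = ∫⁻ v, gaussianReal 0 1 {z | z / √(v / k) ∈ s} ∂chiSquared k := by
  rw [studentT, Measure.map_apply (by fun_prop) hs,
    Measure.prod_apply_symm (hs.preimage (by fun_prop))]
  rfl

lemma studentT_Ioi {k : ℕ} (hk : 0 < k) (y : ℝ) :
    studentT k (Set.Ioi (√k * y)) = ∫⁻ v, gaussianReal 0 1 (Set.Ioi (y * √v)) ∂chiSquared k := by
  rw [studentT_apply k measurableSet_Ioi]
  refine lintegral_congr_ae ?_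
  filter_upwards [ae_pos_chiSquared hk] with v hv
  congr 1
  ext z
  have hk' : (0 : ℝ) < k := by exact_mod_cast hk
  have h1 : 0 < √(v / k) := by positivity
  have h2 : √(k : ℝ) * √(v / k) = √v := by
    rw [← Real.sqrt_mul hk'.le]
    congr 1
    field_simp
  simp only [Set.mem_ofPred_eq, Set.mem_Ioi, lt_div_iff₀ h1]
  rw [mul_right_comm, h2, mul_comm]

/-- Given V = v the Chernoff bound is exp(-y²v/2). Averaging over V is the chi-squared Laplace
transform at y²/2, namely (1 + y²)^(-k/2). -/
lemma studentT_real_Ioi_le {k : ℕ} (hk : 0 < k) {y : ℝ} (hy : 0 ≤ y) :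
    (studentT k).real (Set.Ioi (√k * y)) ≤ Real.exp (-(k / 2 * Real.log (1 + y ^ 2))) := by
  have h := integral_exp_neg_mul_chiSquared k (s := y ^ 2 / 2) (by positivity)
  rw [show 1 + 2 * (y ^ 2 / 2) = 1 + y ^ 2 by ring] at h
  rw [← h, measureReal_def, studentT_Ioi hk]
  refine ENNReal.toReal_le_of_le_ofReal (integral_nonneg fun v => (Real.exp_pos _).le) ?_
  rw [ofReal_integral_eq_lintegral_ofReal (integrable_exp_neg_mul_chiSquared hk (by positivity))
    (ae_of_all _ fun v => (Real.exp_pos _).le)]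
  refine lintegral_mono_ae ?_
  filter_upwards [ae_pos_chiSquared hk] with v hv
  rw [← ofReal_measureReal]
  refine ENNReal.ofReal_le_ofReal ((gaussianReal_real_Ioi_le (by positivity)).trans_eq ?_)
  rw [mul_pow, Real.sq_sqrt hv.le]
  congr 1
  ring

/-- The same conditioning with the Gaussian lower bound. That `c` depends on neither k nor y makes
it negligible on the exponential scale. -/
lemma exists_le_studentT_real_Ioi {η : ℝ} (hη : 0 < η) :
    ∃ c : ℝ, 0 < c ∧ ∀ k : ℕ, 0 < k → ∀ y : ℝ, 0 ≤ y →
      c * Real.exp (-(k / 2 * Real.log (1 + (1 + η) * y ^ 2))) ≤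
        (studentT k).real (Set.Ioi (√k * y)) := by
  obtain ⟨c, hc, hle⟩ := exists_le_gaussianReal_real_Ioi hη
  refine ⟨c, hc, fun k hk y hy => ?_⟩
  have h := integral_exp_neg_mul_chiSquared k (s := (1 + η) * y ^ 2 / 2) (by positivity)
  rw [show 1 + 2 * ((1 + η) * y ^ 2 / 2) = 1 + (1 + η) * y ^ 2 by ring] at h
  rw [← h, ← integral_const_mul, measureReal_def,
    ← ENNReal.ofReal_le_iff_le_toReal (measure_ne_top _ _), studentT_Ioi hk,
    ofReal_integral_eq_lintegral_ofReal
      ((integrable_exp_neg_mul_chiSquared hk (by positivity)).const_mul c)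
    (ae_of_all _ fun v => by positivity)]
  refine lintegral_mono_ae ?_
  filter_upwards [ae_pos_chiSquared hk] with v hv
  rw [← ofReal_measureReal]
  refine ENNReal.ofReal_le_ofReal (le_trans (le_of_eq ?_) (hle (y * √v) (by positivity)))
  rw [mul_pow, Real.sq_sqrt hv.le]
  congr 2
  ring

lemma studentT_singleton {k : ℕ} (hk : 0 < k) (x : ℝ) : studentT k {x} = 0 := by
  have := nullSingletonClass_gaussianReal (μ := 0) (v := 1) one_ne_zero
  rw [studentT_apply k (measurableSet_singleton x)]
  refine (lintegral_congr_ae ?_).trans lintegral_zero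
  filter_upwards [ae_pos_chiSquared hk] with v hv
  have hk' : (0 : ℝ) < k := by exact_mod_cast hk
  have h1 : 0 < √(v / k) := by positivity
  refine measure_mono_null (t := {x * √(v / k)}) (fun z hz => ?_) (measure_singleton _)
  simp only [Set.mem_ofPred_eq, Set.mem_singleton_iff, div_eq_iff h1.ne'] at hz
  exact hz

lemma map_neg_studentT (k : ℕ) : (studentT k).map (fun x => -x) = studentT k := by
  have h : ((gaussianReal 0 1).prod (chiSquared k)).map (Prod.map (fun x => -x) id) =
      (gaussianReal 0 1).prod (chiSquared k) := by
    rw [← Measure.map_prod_map _ _ measurable_neg measurable_id, gaussianReal_map_neg,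
      Measure.map_id, neg_zero]
  conv_rhs => rw [studentT, ← h]
  rw [studentT, Measure.map_map (by fun_prop) (by fun_prop),
    Measure.map_map (by fun_prop) (by fun_prop)]
  congr 1
  ext p
  simp [neg_div]

/-! ### Quantiles -/

lemma nonempty_quantileSet (ν : Measure ℝ) [IsProbabilityMeasure ν] {p : ℝ} (hp : p < 1) :
    {x : ℝ | p ≤ ν.real (Set.Iic x)}.Nonempty := by
  simp_rw [← cdf_eq_real]
  exact ((tendsto_cdf_atTop ν).eventually (eventually_ge_nhds hp)).exists

lemma bddBelow_quantileSet (ν : Measure ℝ) [IsProbabilityMeasure ν] {p : ℝ} (hp : 0 < p) :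
    BddBelow {x : ℝ | p ≤ ν.real (Set.Iic x)} := by
  simp_rw [← cdf_eq_real]
  obtain ⟨a, ha⟩ := ((tendsto_cdf_atBot ν).eventually (eventually_lt_nhds hp)).exists
  exact ⟨a, fun x hx => le_of_not_gt fun h => (hx.trans (monotone_cdf ν h.le)).not_gt ha⟩

variable {k : ℕ} {p : ℝ}

lemma tQuantile_le {x : ℝ} (hp : 0 < p) (h : (studentT k).real (Set.Ioi x) ≤ 1 - p) :
    tQuantile k p ≤ x := by
  refine csInf_le (bddBelow_quantileSet _ hp) ?_
  have := probReal_add_probReal_compl (μ := studentT k) (measurableSet_Iic (a := x))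
  rw [Set.compl_Iic] at this
  simp only [Set.mem_ofPred_eq]
  linarith

lemma le_tQuantile {x : ℝ} (hp : p < 1) (h : 1 - p < (studentT k).real (Set.Ioi x)) :
    x ≤ tQuantile k p := by
  refine le_csInf (nonempty_quantileSet _ hp) fun y hy => le_of_not_gt fun hyx => ?_
  have h1 := probReal_add_probReal_compl (μ := studentT k) (measurableSet_Iic (a := x))
  rw [Set.compl_Iic] at h1
  have h2 : (studentT k).real (Set.Iic y) ≤ (studentT k).real (Set.Iic x) :=
    measureReal_mono (Set.Iic_subset_Iic.2 hyx.le)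
  have h3 : p ≤ (studentT k).real (Set.Iic y) := hy
  linarith

lemma le_studentT_real_Iic_tQuantile (hp : p < 1) :
    p ≤ (studentT k).real (Set.Iic (tQuantile k p)) := by
  rw [← cdf_eq_real]
  set q := tQuantile k p
  have hc : Tendsto (cdf (studentT k)) (𝓝[>] q) (𝓝 (cdf (studentT k) q)) :=
    ((cdf (studentT k)).right_continuous q).mono_left (nhdsWithin_mono _ Set.Ioi_subset_Ici_self)
  refine ge_of_tendsto hc ?_
  filter_upwards [self_mem_nhdsWithin] with x hx
  obtain ⟨y, hy, hyx⟩ := exists_lt_of_csInf_lt (nonempty_quantileSet (studentT k) hp) hx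
  refine le_trans ?_ (monotone_cdf _ hyx.le)
  rwa [cdf_eq_real]

/-- The distribution function is at most p to the left of the quantile, and the absence of atoms
carries this to the quantile itself. -/
lemma studentT_real_Iic_tQuantile_le (hk : 0 < k) (hp : 0 < p) :
    (studentT k).real (Set.Iic (tQuantile k p)) ≤ p := by
  set F := cdf (studentT k)
  set q := tQuantile k p
  have h0 : F.measure {q} = 0 := by rw [measure_cdf, studentT_singleton hk]
  rw [StieltjesFunction.measure_singleton, ENNReal.ofReal_eq_zero, sub_nonpos] at h0
  rw [← cdf_eq_real]
  refine h0.trans (le_of_tendsto (F.mono.tendsto_leftLim q) ?_)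
  filter_upwards [self_mem_nhdsWithin] with x hx
  refine le_of_not_gt fun h => (notMem_of_lt_csInf hx (bddBelow_quantileSet (studentT k) hp)) ?_
  rw [cdf_eq_real] at h
  exact h.le

lemma studentT_real_Ioi_tQuantile (hk : 0 < k) (hp : 0 < p) (hp' : p < 1) :
    (studentT k).real (Set.Ioi (tQuantile k p)) = 1 - p := by
  have h1 := probReal_add_probReal_compl (μ := studentT k) (measurableSet_Iic (a := tQuantile k p))
  rw [Set.compl_Iic] at h1
  have := le_antisymm (studentT_real_Iic_tQuantile_le hk hp) (le_studentT_real_Iic_tQuantile hp')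
  linarith

/-! ### Asymptotics of extreme quantiles -/

variable {κ : ℕ → ℕ} {L : ℕ → ℝ} {ℓ y : ℝ}

/-- The tail at √k y decays at a rate exceeding ℓ, hence faster than exp(-L). Uniformity in p
matters because the stage-two level is random. -/
lemma eventually_tQuantile_le (hκ : Tendsto κ atTop atTop)
    (hL : Tendsto (fun m => L m / κ m) atTop (𝓝 ℓ)) (hy : 0 ≤ y)
    (hlt : ℓ < 1 / 2 * Real.log (1 + y ^ 2)) :
    ∀ᶠ m in atTop, ∀ p, 0 < p → Real.exp (-L m) ≤ 1 - p → tQuantile (κ m) p ≤ √(κ m) * y := by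
  filter_upwards [hκ.eventually_gt_atTop 0, hL.eventually_lt_const hlt] with m hm hLm p hp hpL
  have hm' : (0 : ℝ) < κ m := by exact_mod_cast hm
  refine tQuantile_le hp ((studentT_real_Ioi_le hm hy).trans (le_trans ?_ hpL))
  rw [div_lt_iff₀ hm'] at hLm
  gcongr
  linarith

lemma eventually_le_tQuantile (hκ : Tendsto κ atTop atTop)
    (hL : Tendsto (fun m => L m / κ m) atTop (𝓝 ℓ)) (hy : 0 ≤ y)
    (hlt : 1 / 2 * Real.log (1 + y ^ 2) < ℓ) :
    ∀ᶠ m in atTop, ∀ p, p < 1 → 1 - p ≤ Real.exp (-L m) → √(κ m) * y ≤ tQuantile (κ m) p := by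
  have hcont : Tendsto (fun η : ℝ => 1 / 2 * Real.log (1 + (1 + η) * y ^ 2)) (𝓝[>] 0)
      (𝓝 (1 / 2 * Real.log (1 + (1 + 0) * y ^ 2))) := by
    refine Tendsto.mono_left ?_ nhdsWithin_le_nhds
    refine ((Real.continuousAt_log (by positivity)).tendsto.comp ?_).const_mul _
    exact Continuous.tendsto (by fun_prop) _
  rw [add_zero, one_mul] at hcont
  -- The strict inequality leaves room for the loss 1 + η; the constant c then only adds log c / κ →
  -- 0 to the rate.
  obtain ⟨η, hη, hη0⟩ := ((hcont.eventually_lt_const hlt).and self_mem_nhdsWithin).exists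
  obtain ⟨c, hc, hle⟩ := exists_le_studentT_real_Ioi (Set.mem_Ioi.1 hη0)
  have hκ' : Tendsto (fun m => (κ m : ℝ)) atTop atTop := tendsto_natCast_atTop_atTop.comp hκ
  have hlim : Tendsto (fun m => L m / κ m + Real.log c / κ m) atTop (𝓝 ℓ) := by
    simpa using hL.add (hκ'.const_div_atTop (Real.log c))
  filter_upwards [hκ.eventually_gt_atTop 0, hlim.eventually_const_lt hη] with m hm hLm p hp hpL
  have hm' : (0 : ℝ) < κ m := by exact_mod_cast hm
  refine le_tQuantile hp (lt_of_lt_of_le (hpL.trans_lt ?_) (hle (κ m) hm y hy))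
  rw [← add_div, lt_div_iff₀ hm'] at hLm
  nth_rw 1 [← Real.exp_log hc]
  rw [← Real.exp_add]
  gcongr
  linarith

/-! ### Law of the one-sample `t`-statistic -/

/-- Rotating to this basis isolates the sample mean in coordinate 0 and leaves the residuals in the
other k coordinates. -/
lemma exists_orthonormalBasis_const (k : ℕ) :
    ∃ b : OrthonormalBasis (Fin (k + 1)) ℝ (EuclideanSpace ℝ (Fin (k + 1))),
      ∀ j, b 0 j = (√((k + 1 : ℕ) : ℝ))⁻¹ := by
  let u : EuclideanSpace ℝ (Fin (k + 1)) := WithLp.toLp 2 fun _ => (√((k + 1 : ℕ) : ℝ))⁻¹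
  have hu : ‖u‖ = 1 := by
    rw [EuclideanSpace.norm_eq, Real.sqrt_eq_one]
    simp only [u, Real.norm_eq_abs, sq_abs, inv_pow, Finset.sum_const, Finset.card_univ,
      Fintype.card_fin, nsmul_eq_mul]
    rw [Real.sq_sqrt (by positivity)]
    exact mul_inv_cancel₀ (by positivity)
  have hv : Orthonormal ℝ (({0} : Set (Fin (k + 1))).domRestrict fun _ => u) := by
    refine ⟨fun _ => hu, fun i j hij => absurd (Subsingleton.elim i j) hij⟩
  obtain ⟨b, hb⟩ := hv.exists_orthonormalBasis_extension_of_card_eq (by simp)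
  refine ⟨b, fun j => ?_⟩
  rw [hb 0 rfl]

lemma map_pi_gaussianReal_orthonormalBasis {ι : Type*} [Fintype ι]
    (b : OrthonormalBasis ι ℝ (EuclideanSpace ℝ ι)) :
    (Measure.pi fun _ : ι => gaussianReal 0 1).map (fun z j => (∑ i, z i • b i) j) =
      Measure.pi fun _ : ι => gaussianReal 0 1 := by
  have h := (map_pi_eq_stdGaussian (ι := ι)).trans (stdGaussian_eq_map_pi_orthonormalBasis b)
  have h' := congrArg (Measure.map (WithLp.ofLp (p := 2))) h
  rw [Measure.map_map (by fun_prop) (by fun_prop), Measure.map_map (by fun_prop) (by fun_prop)] at h'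
  have h2 : (WithLp.ofLp (p := 2)) ∘ (WithLp.toLp 2 : (ι → ℝ) → _) = id := rfl
  rw [h2, Measure.map_id] at h'
  exact h'.symm

/-- Pairing with b 0 gives the sum of the observations, and Parseval preserves the sum of squares;
subtracting the mean part removes exactly z 0 ². The shift a moves only the mean. -/
lemma tStat_orthonormalBasis {k : ℕ} (b : OrthonormalBasis (Fin (k + 1)) ℝ
    (EuclideanSpace ℝ (Fin (k + 1)))) (hb : ∀ j, b 0 j = (√((k + 1 : ℕ) : ℝ))⁻¹) (a : ℝ)
    (z : Fin (k + 1) → ℝ) :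
    tStat (fun j => (∑ i, z i • b i) j + a) =
      (z 0 + √((k + 1 : ℕ) : ℝ) * a) / √((∑ j : Fin k, z j.succ ^ 2) / k) := by
  set x : EuclideanSpace ℝ (Fin (k + 1)) := ∑ i, z i • b i
  set s : ℝ := √((k + 1 : ℕ) : ℝ)
  have hs : 0 < s := by positivity
  have hs2 : ((k + 1 : ℕ) : ℝ) = s ^ 2 := (Real.sq_sqrt (by positivity)).symm
  have hrepr : ∀ i, b.repr x i = z i := fun i => by
    rw [OrthonormalBasis.repr_apply_apply]
    exact b.orthonormal.inner_right_fintype z i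
  have hsum : ∑ j, x j = s * z 0 := by
    rw [← hrepr 0, OrthonormalBasis.repr_apply_apply, PiLp.inner_apply]
    simp only [hb, RCLike.inner_apply, conj_trivial]
    rw [← Finset.sum_mul]
    field_simp
  have hsq : ∑ j, x j ^ 2 = ∑ i, z i ^ 2 := by
    rw [← EuclideanSpace.real_norm_sq_eq, ← b.repr.norm_map, EuclideanSpace.real_norm_sq_eq]
    simp_rw [hrepr]
  have hmean : sampleMean (fun j => x j + a) = z 0 / s + a := by
    rw [sampleMean, Finset.sum_add_distrib, hsum, Finset.sum_const, Finset.card_univ,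
      Fintype.card_fin, nsmul_eq_mul, hs2]
    field_simp
  have hvar : sampleVar (fun j => x j + a) = (∑ j : Fin k, z j.succ ^ 2) / k := by
    rw [sampleVar, hmean]
    congr 1
    · have h1 : ∀ j, (x j + a - (z 0 / s + a)) ^ 2 =
          x j ^ 2 - 2 * (z 0 / s) * x j + (z 0 / s) ^ 2 := fun j => by ring
      simp_rw [h1]
      rw [Finset.sum_add_distrib, Finset.sum_sub_distrib, ← Finset.mul_sum, hsum, hsq,
        Finset.sum_const, Finset.card_univ, Fintype.card_fin, nsmul_eq_mul, hs2, Fin.sum_univ_succ]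
      field_simp
      ring
    · simp
  rw [tStat, hvar, hmean]
  congr 1
  change s * (z 0 / s + a) = z 0 + s * a
  field_simp

@[fun_prop]
lemma measurable_sampleMean (k : ℕ) : Measurable (sampleMean (k := k)) := by
  unfold sampleMean
  fun_prop

@[fun_prop]
lemma measurable_sampleVar (k : ℕ) : Measurable (sampleVar (k := k)) := by
  unfold sampleVar
  fun_prop

@[fun_prop]
lemma measurable_tStat (k : ℕ) : Measurable (tStat (k := k)) := by
  unfold tStat
  fun_prop

/-- The law of the `t`-statistic of `k + 1` independent `N(a, 1)` observations: a noncentral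
`t`-distribution with `k` degrees of freedom. -/
lemma map_tStat_pi_gaussianReal (k : ℕ) (a : ℝ) :
    (Measure.pi fun _ : Fin (k + 1) => gaussianReal a 1).map tStat =
      ((gaussianReal 0 1).prod (chiSquared k)).map
        fun p => (p.1 + √((k + 1 : ℕ) : ℝ) * a) / √(p.2 / k) := by
  obtain ⟨b, hb⟩ := exists_orthonormalBasis_const k
  have h1 : (Measure.pi fun _ : Fin (k + 1) => gaussianReal a 1) =
      (Measure.pi fun _ : Fin (k + 1) => gaussianReal 0 1).map (fun z j => z j + a) := by
    have hg : (gaussianReal 0 1).map (fun x => x + a) = gaussianReal a 1 := by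
      rw [gaussianReal_map_add_const, zero_add]
    rw [Measure.pi_map_pi (f := fun _ x => x + a) (fun _ => by fun_prop), hg]
  have h2 : (gaussianReal 0 1).prod (chiSquared k) =
      (Measure.pi fun _ : Fin (k + 1) => gaussianReal 0 1).map
        fun z => (z 0, ∑ j : Fin k, z j.succ ^ 2) := by
    have hm := (measurePreserving_piFinSuccAbove (fun _ : Fin (k + 1) => gaussianReal 0 1) 0).map_eq
    rw [chiSquared]
    nth_rw 1 [← Measure.map_id (μ := gaussianReal 0 1)]
    rw [Measure.map_prod_map _ _ measurable_id (measurable_sum_sq k)]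
    rw [← hm, Measure.map_map (by fun_prop) (by fun_prop)]
    congr 1
  -- The rotation is inserted on both sides but wanted only on the left; it is undone on the right.
  rw [h1, h2, ← map_pi_gaussianReal_orthonormalBasis b, Measure.map_map (by fun_prop) (by fun_prop),
    Measure.map_map (by fun_prop) (by fun_prop), map_pi_gaussianReal_orthonormalBasis b,
    Measure.map_map (by fun_prop) (by fun_prop)]
  congr 1
  funext z
  exact tStat_orthonormalBasis b hb a z

lemma map_tStat_pi_gaussianReal_zero (k : ℕ) :
    (Measure.pi fun _ : Fin (k + 1) => gaussianReal 0 1).map tStat = studentT k := by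
  rw [map_tStat_pi_gaussianReal, studentT]
  simp

/-! ### Concentration of the one-sample `t`-statistic -/

lemma gaussianReal_real_abs_ge_le {c : ℝ} (hc : 0 < c) :
    (gaussianReal 0 1).real {z | c ≤ |z|} ≤ 1 / c ^ 2 := by
  have h := meas_ge_le_variance_div_sq (μ := gaussianReal 0 1) (memLp_id_gaussianReal 2) hc
  rw [variance_id_gaussianReal] at h
  refine ENNReal.toReal_le_of_le_ofReal (by positivity) ?_
  simpa using h

lemma chiSquared_real_abs_sub_ge_le (k : ℕ) {c : ℝ} (hc : 0 < c) :
    (chiSquared k).real {v | c ≤ |v - k|} ≤ k * Var[fun z => z ^ 2; gaussianReal 0 1] / c ^ 2 := by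
  have hsq : MemLp (fun z : ℝ => z ^ 2) 2 (gaussianReal 0 1) := by
    have h4 : MemLp (id : ℝ → ℝ) 4 (gaussianReal 0 1) := memLp_id_gaussianReal 4
    have h := h4.norm_rpow_div (q := 2)
    have h2 : (4 : ENNReal) / 2 = 2 := by
      exact ((ENNReal.eq_div_iff (by simp) (by simp)).2 (by norm_num)).symm
    rw [h2] at h
    simpa using h
  have hint : ∫ z, z ^ 2 ∂gaussianReal 0 1 = 1 := by
    have h := variance_of_integral_eq_zero (X := fun x : ℝ => x) (μ := gaussianReal 0 1)
      aemeasurable_id integral_id_gaussianReal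
    rw [variance_fun_id_gaussianReal] at h
    simpa using h.symm
  set ν := Measure.pi fun _ : Fin k => gaussianReal 0 1
  have hmem : ∀ j : Fin k, MemLp (fun z : Fin k → ℝ => z j ^ 2) 2 ν := fun j =>
    hsq.comp_measurePreserving (measurePreserving_eval (fun _ : Fin k => gaussianReal 0 1) j)
  have hmean : ∫ z, ∑ j, z j ^ 2 ∂ν = k := by
    rw [integral_finsetSum _ fun j _ => (hmem j).integrable one_le_two]
    have : ∀ j : Fin k, ∫ z, z j ^ 2 ∂ν = 1 := fun j => by
      rw [← hint]
      exact integral_comp_eval (μ := fun _ : Fin k => gaussianReal 0 1) (i := j)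
        (f := fun z : ℝ => z ^ 2) (by fun_prop)
    simp [this]
  have hvar : Var[fun z => ∑ j, z j ^ 2; ν] = k * Var[fun z => z ^ 2; gaussianReal 0 1] := by
    have h := variance_sum_pi (μ := fun _ : Fin k => gaussianReal 0 1)
      (X := fun _ z => z ^ 2) (fun _ => hsq)
    simp only [Finset.sum_const, Finset.card_univ, Fintype.card_fin, nsmul_eq_mul] at h
    rw [← h]
    congr 1
    ext z
    simp
  have hL : MemLp (fun z : Fin k → ℝ => ∑ j, z j ^ 2) 2 ν := memLp_finsetSum _ fun j _ => hmem j
  have h := meas_ge_le_variance_div_sq hL hc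
  rw [hmean, hvar] at h
  refine ENNReal.toReal_le_of_le_ofReal (div_nonneg (mul_nonneg (by positivity)
    (variance_nonneg _ _)) (by positivity)) ?_
  rwa [chiSquared, Measure.map_apply (measurable_sum_sq k)
    (measurableSet_le measurable_const (by fun_prop))]

/-- Chebyshev for numerator and denominator. Off this event the noncentral t-variable is pinned
deterministically near √k |a|. -/
lemma exists_prod_real_bad_le : ∃ C : ℝ, ∀ k : ℕ, 0 < k → ∀ δ : ℝ, 0 < δ →
    ((gaussianReal 0 1).prod (chiSquared k)).real
      {p | |p.1| < δ * √k ∧ |p.2 - k| < δ * k}ᶜ ≤ C / (δ ^ 2 * k) := by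
  set C := Var[fun z => z ^ 2; gaussianReal 0 1]
  refine ⟨1 + C, fun k hk δ hδ => ?_⟩
  have hk' : (0 : ℝ) < k := by exact_mod_cast hk
  have hsub : {p : ℝ × ℝ | |p.1| < δ * √k ∧ |p.2 - k| < δ * k}ᶜ ⊆
      {z : ℝ | δ * √k ≤ |z|} ×ˢ Set.univ ∪ Set.univ ×ˢ {v : ℝ | δ * k ≤ |v - k|} := by
    intro p hp
    simp only [Set.mem_compl_iff, Set.mem_ofPred_eq, not_and_or, not_lt] at hp
    simpa using hp
  refine (measureReal_mono hsub).trans ((measureReal_union_le _ _).trans ?_)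
  rw [measureReal_prod_prod, measureReal_prod_prod, probReal_univ, probReal_univ, mul_one, one_mul]
  have h1 := gaussianReal_real_abs_ge_le (c := δ * √k) (by positivity)
  have h2 := chiSquared_real_abs_sub_ge_le k (c := δ * k) (by positivity)
  refine (add_le_add h1 h2).trans_eq ?_
  rw [mul_pow, Real.sq_sqrt hk'.le, add_div]
  congr 1
  change k * C / _ = _
  field_simp

variable {k : ℕ} {z v a δ y : ℝ}

lemma abs_noncentral_le (hk : 0 < k) (hδ' : δ < 1) (hδk : 1 ≤ δ * k)
    (hz : |z| < δ * √k) (hv : |v - k| < δ * k) :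
    |(z + √((k + 1 : ℕ) : ℝ) * a) / √(v / k)| ≤ √k * ((δ + √(1 + δ) * |a|) / √(1 - δ)) := by
  have hk' : (0 : ℝ) < k := by exact_mod_cast hk
  have hδ : 0 < δ := by
    by_contra h
    nlinarith
  -- There are k + 1 observations but k degrees of freedom; 1 ≤ δk absorbs the extra one.
  have h1 : √((k + 1 : ℕ) : ℝ) ≤ √k * √(1 + δ) := by
    rw [← Real.sqrt_mul hk'.le]
    refine Real.sqrt_le_sqrt ?_
    push_cast
    linarith
  have h2 : 1 - δ ≤ v / k := by
    rw [le_div_iff₀ hk']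
    linarith [(abs_lt.1 hv).1]
  have h3 : 0 < 1 - δ := by linarith
  rw [abs_div, abs_of_nonneg (Real.sqrt_nonneg (v / k)), ← mul_div_assoc]
  refine div_le_div₀ (by positivity) ?_ (by positivity) (Real.sqrt_le_sqrt h2)
  refine (abs_add_le _ _).trans ?_
  rw [abs_mul, abs_of_nonneg (Real.sqrt_nonneg _)]
  nlinarith [mul_le_mul_of_nonneg_right h1 (abs_nonneg a)]

lemma le_abs_noncentral (hk : 0 < k) (hδ' : δ < 1)
    (hz : |z| < δ * √k) (hv : |v - k| < δ * k) :
    √k * ((|a| - δ) / √(1 + δ)) ≤ |(z + √((k + 1 : ℕ) : ℝ) * a) / √(v / k)| := by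
  have hk' : (0 : ℝ) < k := by exact_mod_cast hk
  have h1 : √(k : ℝ) ≤ √((k + 1 : ℕ) : ℝ) := Real.sqrt_le_sqrt (by push_cast; linarith)
  have h2 : v / k ≤ 1 + δ := by
    rw [div_le_iff₀ hk']
    linarith [(abs_lt.1 hv).2]
  have hv0 : 0 < v / k := by
    have := (abs_lt.1 hv).1
    have : 0 < v := by nlinarith
    positivity
  rw [abs_div, abs_of_nonneg (Real.sqrt_nonneg (v / k)), ← mul_div_assoc]
  refine div_le_div₀ (abs_nonneg _) ?_ (by positivity) (Real.sqrt_le_sqrt h2)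
  have h3 : |√((k + 1 : ℕ) : ℝ) * a| - |z| ≤ |z + √((k + 1 : ℕ) : ℝ) * a| := by
    have := abs_sub_abs_le_abs_sub (√((k + 1 : ℕ) : ℝ) * a) (-z)
    rw [abs_neg, sub_neg_eq_add, add_comm _ z] at this
    exact this
  rw [abs_mul, abs_of_nonneg (Real.sqrt_nonneg _)] at h3
  nlinarith [mul_le_mul_of_nonneg_right h1 (abs_nonneg a)]

lemma tendsto_pi_gaussianReal_tStat_of_good {n : ℕ → ℕ} (hn : Tendsto n atTop atTop) {a δ : ℝ}
    (hδ : 0 < δ) (s : ℕ → Set ℝ) (hs : ∀ k, MeasurableSet (s k))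
    (hgood : ∀ᶠ k : ℕ in atTop, ∀ z v : ℝ, |z| < δ * √k → |v - k| < δ * k →
      (z + √((k + 1 : ℕ) : ℝ) * a) / √(v / k) ∉ s k) :
    Tendsto (fun m => (Measure.pi fun _ : Fin (n m) => gaussianReal a 1).real
      {x | tStat x ∈ s (n m - 1)}) atTop (𝓝 0) := by
  obtain ⟨C, hC⟩ := exists_prod_real_bad_le
  have key : Tendsto (fun k : ℕ => (Measure.pi fun _ : Fin (k + 1) => gaussianReal a 1).real
      {x | tStat x ∈ s k}) atTop (𝓝 0) := by
    have hlim : Tendsto (fun k : ℕ => C / (δ ^ 2 * k)) atTop (𝓝 0) :=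
      (tendsto_natCast_atTop_atTop.const_mul_atTop (by positivity)).const_div_atTop C
    refine squeeze_zero' (Eventually.of_forall fun k => measureReal_nonneg) ?_ hlim
    filter_upwards [hgood, eventually_gt_atTop 0] with k hk hk0
    have h1 : (Measure.pi fun _ : Fin (k + 1) => gaussianReal a 1).real {x | tStat x ∈ s k} =
        ((Measure.pi fun _ : Fin (k + 1) => gaussianReal a 1).map tStat).real (s k) := by
      rw [map_measureReal_apply (by fun_prop) (hs k)]
      rfl
    rw [h1, map_tStat_pi_gaussianReal, map_measureReal_apply (by fun_prop) (hs k)]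
    refine (measureReal_mono fun p hp => ?_).trans (hC k hk0 δ hδ)
    exact fun hp' => hk p.1 p.2 hp'.1 hp'.2 hp
  have hn1 : Tendsto (fun m => n m - 1) atTop atTop := (tendsto_sub_atTop_nat 1).comp hn
  refine (key.comp hn1).congr' ?_
  filter_upwards [hn.eventually_gt_atTop 0] with m hm
  -- N - 1 + 1 and N index different types, so the identification goes by cases on N.
  have hN : ∀ N : ℕ, 0 < N → (Measure.pi fun _ : Fin (N - 1 + 1) => gaussianReal a 1).real
      {x | tStat x ∈ s (N - 1)} = (Measure.pi fun _ : Fin N => gaussianReal a 1).real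
      {x | tStat x ∈ s (N - 1)} := by
    rintro (_ | N) h
    · exact absurd h (lt_irrefl 0)
    · rfl
  exact hN (n m) hm

lemma tendsto_real_tStat_gt {n : ℕ → ℕ} (hn : Tendsto n atTop atTop) {a y : ℝ} (hy : |a| < y) :
    Tendsto (fun m => (Measure.pi fun _ : Fin (n m) => gaussianReal a 1).real
      {x | √((n m - 1 : ℕ) : ℝ) * y < |tStat x|}) atTop (𝓝 0) := by
  have hc : ContinuousAt (fun δ : ℝ => (δ + √(1 + δ) * |a|) / √(1 - δ)) 0 := by
    refine ContinuousAt.div (by fun_prop) (by fun_prop) (by simp)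
  have h0 : ∀ᶠ δ : ℝ in 𝓝[>] 0, (δ + √(1 + δ) * |a|) / √(1 - δ) < y :=
    (hc.eventually_lt_const (by simpa using hy)).filter_mono nhdsWithin_le_nhds
  have h1 : ∀ᶠ δ : ℝ in 𝓝[>] 0, δ < 1 := (eventually_lt_nhds one_pos).filter_mono nhdsWithin_le_nhds
  obtain ⟨δ, ⟨hδy, hδ1⟩, hδ⟩ := ((h0.and h1).and self_mem_nhdsWithin).exists
  have hδ : 0 < δ := hδ
  refine tendsto_pi_gaussianReal_tStat_of_good hn hδ (fun k => {t | √(k : ℝ) * y < |t|})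
    (fun k => measurableSet_lt measurable_const (by fun_prop)) ?_
  filter_upwards [eventually_gt_atTop 0,
    (tendsto_natCast_atTop_atTop.const_mul_atTop hδ).eventually_ge_atTop 1] with k hk hk1 z v hz hv
  simp only [not_lt]
  exact (abs_noncentral_le hk hδ1 hk1 hz hv).trans (by gcongr)

lemma tendsto_real_tStat_le {n : ℕ → ℕ} (hn : Tendsto n atTop atTop) {a y : ℝ} (hy : y < |a|) :
    Tendsto (fun m => (Measure.pi fun _ : Fin (n m) => gaussianReal a 1).real
      {x | |tStat x| ≤ √((n m - 1 : ℕ) : ℝ) * y}) atTop (𝓝 0) := by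
  have hc : ContinuousAt (fun δ : ℝ => (|a| - δ) / √(1 + δ)) 0 := by
    refine ContinuousAt.div (by fun_prop) (by fun_prop) (by simp)
  have h0 : ∀ᶠ δ : ℝ in 𝓝[>] 0, y < (|a| - δ) / √(1 + δ) :=
    (hc.eventually_const_lt (by simpa using hy)).filter_mono nhdsWithin_le_nhds
  have h1 : ∀ᶠ δ : ℝ in 𝓝[>] 0, δ < 1 :=
    (eventually_lt_nhds one_pos).filter_mono nhdsWithin_le_nhds
  obtain ⟨δ, ⟨hδy, hδ1⟩, hδ⟩ := ((h0.and h1).and self_mem_nhdsWithin).exists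
  have hδ : 0 < δ := hδ
  refine tendsto_pi_gaussianReal_tStat_of_good hn hδ (fun k => {t | |t| ≤ √(k : ℝ) * y})
    (fun k => measurableSet_le (by fun_prop) measurable_const) ?_
  filter_upwards [eventually_gt_atTop 0] with k hk z v hz hv
  simp only [not_le]
  refine lt_of_lt_of_le ?_ (le_abs_noncentral hk hδ1 hz hv)
  gcongr

/-! ### Number of coordinates of a product space that hit a given set -/

open Classical in
lemma sum_indicator_eq_card {ι Ω : Type*} {A : Set Ω} (s : Finset ι) (x : ι → Ω) :
    ∑ i ∈ s, A.indicator (fun _ => (1 : ℝ)) (x i) = (({i ∈ s | x i ∈ A} : Finset ι).card : ℝ) := by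
  simp [Set.indicator_apply]

section Count

variable {ι Ω : Type*} [Fintype ι] [MeasurableSpace Ω] (ν : ι → Measure Ω)
  [∀ i, IsProbabilityMeasure (ν i)] {A : Set Ω}

lemma memLp_indicator_eval (hA : MeasurableSet A) (i : ι) :
    MemLp (fun x : ι → Ω => A.indicator (fun _ => (1 : ℝ)) (x i)) 2 (Measure.pi ν) :=
  (memLp_indicator_const 2 hA (1 : ℝ) (Or.inr (measure_ne_top (ν i) A))).comp_measurePreserving
    (measurePreserving_eval ν i)

lemma integral_sum_indicator_eval (hA : MeasurableSet A) (s : Finset ι) :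
    ∫ x, ∑ i ∈ s, A.indicator (fun _ => (1 : ℝ)) (x i) ∂Measure.pi ν = ∑ i ∈ s, (ν i).real A := by
  rw [integral_finsetSum _ fun i _ => (memLp_indicator_eval ν hA i).integrable one_le_two]
  refine Finset.sum_congr rfl fun i _ => ?_
  rw [integral_comp_eval (μ := ν) (i := i) (f := A.indicator fun _ => (1 : ℝ))
    (aestronglyMeasurable_const.indicator hA), integral_indicator_const _ hA]
  simp

open Classical in
lemma pi_real_card_ge_le (hA : MeasurableSet A) {K : ℝ} (hK : 0 < K) :
    (Measure.pi ν).real {x | K ≤ (({i | x i ∈ A} : Finset ι).card : ℝ)} ≤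
      (∑ i, (ν i).real A) / K := by
  have hint : Integrable (fun x : ι → Ω => ∑ i, A.indicator (fun _ => (1 : ℝ)) (x i))
      (Measure.pi ν) :=
    integrable_finsetSum _ fun i _ => (memLp_indicator_eval ν hA i).integrable one_le_two
  have h := mul_meas_ge_le_integral_of_nonneg (ae_of_all _ fun x => Finset.sum_nonneg fun i _ =>
    Set.indicator_nonneg (fun _ _ => zero_le_one) _) hint K
  rw [integral_sum_indicator_eval ν hA] at h
  simp_rw [sum_indicator_eq_card] at h
  rwa [le_div_iff₀' hK]

open Classical in
-- Chebyshev: by independence the variance of the count over s is at most its mean E, so a deviation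
-- of E/2 has probability at most 4/E. Taking s to be the true nulls avoids any estimate for the
-- other coordinates.
lemma pi_real_card_le_le (hA : MeasurableSet A) (s : Finset ι) {M : ℝ} (hM : 0 < M)
    (hMs : M ≤ ∑ i ∈ s, (ν i).real A) :
    (Measure.pi ν).real {x | (({i | x i ∈ A} : Finset ι).card : ℝ) ≤ M / 2} ≤ 4 / M := by
  set E := ∑ i ∈ s, (ν i).real A
  have hE : 0 < E := hM.trans_le hMs
  have hmem : MemLp (fun x : ι → Ω => ∑ i ∈ s, A.indicator (fun _ => (1 : ℝ)) (x i)) 2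
      (Measure.pi ν) := memLp_finsetSum _ fun i _ => memLp_indicator_eval ν hA i
  have hvar : Var[fun x : ι → Ω => ∑ i ∈ s, A.indicator (fun _ => (1 : ℝ)) (x i);
      Measure.pi ν] ≤ E := by
    have h1 := IndepFun.variance_sum (s := s) (μ := Measure.pi ν)
      (X := fun i (x : ι → Ω) => A.indicator (fun _ => (1 : ℝ)) (x i))
      (fun i _ => memLp_indicator_eval ν hA i)
      (fun i _ j _ hij => (iIndepFun_pi (μ := ν) (X := fun _ => A.indicator fun _ => (1 : ℝ))
        fun _ => (measurable_const.indicator hA).aemeasurable).indepFun hij)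
    have h2 : (∑ i ∈ s, fun x : ι → Ω => A.indicator (fun _ => (1 : ℝ)) (x i)) =
        fun x => ∑ i ∈ s, A.indicator (fun _ => (1 : ℝ)) (x i) := by
      ext x
      simp
    rw [← h2, h1]
    refine Finset.sum_le_sum fun i _ => ?_
    refine (variance_le_expectation_sq (memLp_indicator_eval ν hA i).aestronglyMeasurable).trans_eq ?_
    have h3 := integral_sum_indicator_eval ν hA {i}
    simp only [Finset.sum_singleton] at h3
    rw [← h3]
    refine integral_congr_ae (ae_of_all _ fun x => ?_)
    by_cases hx : x i ∈ A <;> simp [hx]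
  have h := meas_ge_le_variance_div_sq hmem (c := E / 2) (by positivity)
  rw [integral_sum_indicator_eval ν hA] at h
  have h' : (Measure.pi ν).real {x : ι → Ω | E / 2 ≤
      |∑ i ∈ s, A.indicator (fun _ => (1 : ℝ)) (x i) - E|} ≤ 4 / M := by
    refine (ENNReal.toReal_le_of_le_ofReal (div_nonneg (variance_nonneg _ _) (by positivity)) h).trans
      ((div_le_div_of_nonneg_right hvar (by positivity)).trans ?_)
    have : E / (E / 2) ^ 2 = 4 / E := by field_simp; norm_num
    rw [this]
    gcongr
  refine (measureReal_mono fun x hx => ?_).trans h'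
  simp only [Set.mem_ofPred_eq] at hx ⊢
  have h4 : (({i ∈ s | x i ∈ A} : Finset ι).card : ℝ) ≤ (({i | x i ∈ A} : Finset ι).card : ℝ) := by
    exact_mod_cast Finset.card_le_card (Finset.filter_subset_filter _ (Finset.subset_univ s))
  rw [sum_indicator_eq_card, abs_sub_comm]
  refine le_trans ?_ (le_abs_self _)
  linarith

end Count

/-! ### Marginals of the data -/

instance {m n : ℕ} (μ : Fin m → ℝ) : IsProbabilityMeasure (dataLaw n μ) := by
  unfold dataLaw
  infer_instance

lemma measurePreserving_comp_injective {ι κ Ω : Type*} [Fintype ι] [Fintype κ] [MeasurableSpace Ω]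
    (ν : Measure Ω) [IsProbabilityMeasure ν] {e : κ → ι} (he : Function.Injective e) :
    MeasurePreserving (fun (x : ι → Ω) j => x (e j)) (Measure.pi fun _ => ν)
      (Measure.pi fun _ => ν) := by
  refine ⟨by fun_prop, ?_⟩
  have h := (iIndepFun_pi (μ := fun _ : ι => ν) (X := fun _ x => x)
    fun _ => aemeasurable_id).precomp he
  rw [iIndepFun_iff_map_fun_eq_pi_map fun j => (measurable_pi_apply (e j)).aemeasurable] at h
  rw [h]
  congr 1
  funext j
  exact (measurePreserving_eval (fun _ : ι => ν) (e j)).map_eq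

variable {m n₁ n₂ : ℕ} (μ : Fin m → ℝ) (i : Fin m)

lemma dataLaw_real_tStat₁ {s : Set ℝ} (hs : MeasurableSet s) :
    (dataLaw (n₁ + n₂) μ).real {x | tStat₁ x i ∈ s} =
      (Measure.pi fun _ : Fin n₁ => gaussianReal (μ i) 1).real {x | tStat x ∈ s} := by
  have h := (measurePreserving_comp_injective (gaussianReal (μ i) 1)
    (Fin.castAdd_injective n₁ n₂)).comp (measurePreserving_eval
      (fun i : Fin m => Measure.pi fun _ : Fin (n₁ + n₂) => gaussianReal (μ i) 1) i)
  exact h.measureReal_preimage (hs.preimage (measurable_tStat n₁)).nullMeasurableSet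

lemma dataLaw_real_tStat₂ {s : Set ℝ} (hs : MeasurableSet s) :
    (dataLaw (n₁ + n₂) μ).real {x | tStat₂ x i ∈ s} =
      (Measure.pi fun _ : Fin n₂ => gaussianReal (μ i) 1).real {x | tStat x ∈ s} := by
  have h := (measurePreserving_comp_injective (gaussianReal (μ i) 1)
    (Fin.natAdd_injective n₂ n₁)).comp (measurePreserving_eval
      (fun i : Fin m => Measure.pi fun _ : Fin (n₁ + n₂) => gaussianReal (μ i) 1) i)
  exact h.measureReal_preimage (hs.preimage (measurable_tStat n₂)).nullMeasurableSet

/-! ### Size of the first-stage selection -/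

lemma pi_gaussianReal_real_tStat_gt_tQuantile {n : ℕ} (hn : 2 ≤ n) {p : ℝ} (hp : 0 < p)
    (hp' : p < 1) :
    1 - p ≤ (Measure.pi fun _ : Fin n => gaussianReal 0 1).real
        {x | tQuantile (n - 1) p < |tStat x|} ∧
      (Measure.pi fun _ : Fin n => gaussianReal 0 1).real
        {x | tQuantile (n - 1) p < |tStat x|} ≤ 2 * (1 - p) := by
  obtain ⟨k, rfl⟩ := Nat.exists_eq_add_of_le' (one_le_two.trans hn)
  have hk : 0 < k := by omega
  rw [Nat.add_sub_cancel]
  set q := tQuantile k p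
  have hq := studentT_real_Ioi_tQuantile hk hp hp'
  have h : (Measure.pi fun _ : Fin (k + 1) => gaussianReal 0 1).real {x | q < |tStat x|} =
      (studentT k).real {t | q < |t|} := by
    rw [← map_tStat_pi_gaussianReal_zero, map_measureReal_apply (by fun_prop)
      (measurableSet_lt measurable_const (by fun_prop))]
    rfl
  rw [h, ← hq]
  refine ⟨measureReal_mono fun t ht => lt_of_lt_of_le ht (le_abs_self t), ?_⟩
  have hneg : (studentT k).real {t | q < -t} = (studentT k).real (Set.Ioi q) := by
    conv_rhs => rw [← map_neg_studentT, map_measureReal_apply (by fun_prop) measurableSet_Ioi]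
    rfl
  have hsub : {t : ℝ | q < |t|} ⊆ Set.Ioi q ∪ {t | q < -t} := fun t ht => by
    simpa using lt_abs.1 ht
  refine (measureReal_mono hsub).trans ((measureReal_union_le _ _).trans_eq ?_)
  rw [hneg]
  ring

section Selection

variable {m n₁ n₂ : ℕ} {γ K M : ℝ} (μ : Fin m → ℝ)

lemma selectionLevel_mem (hm : 0 < m) (hγ : γ ≤ 1) :
    0 < 1 - (m : ℝ) ^ (γ - 1) / 2 ∧ 1 - (m : ℝ) ^ (γ - 1) / 2 < 1 := by
  have hm' : (1 : ℝ) ≤ m := by exact_mod_cast hm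
  have h1 : (m : ℝ) ^ (γ - 1) ≤ 1 := Real.rpow_le_one_of_one_le_of_nonpos hm' (by linarith)
  have h2 : 0 < (m : ℝ) ^ (γ - 1) := by positivity
  constructor <;> linarith

lemma numFalse_eq_card : numFalse μ = (Finset.univ.filter fun i => μ i ≠ 0).card := by
  rw [numFalse, Nat.card_eq_fintype_card, Fintype.card_subtype]

lemma pi_real_selection {n₁ n₂ : ℕ} (a q : ℝ) :
    (Measure.pi fun _ : Fin (n₁ + n₂) => gaussianReal a 1).real
        {w | q < |tStat fun j : Fin n₁ => w (Fin.castAdd n₂ j)|} =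
      (Measure.pi fun _ : Fin n₁ => gaussianReal a 1).real {x | q < |tStat x|} := by
  have hs : MeasurableSet {x : Fin n₁ → ℝ | q < |tStat x|} :=
    measurableSet_lt measurable_const (by fun_prop)
  exact (measurePreserving_comp_injective (gaussianReal a 1)
    (Fin.castAdd_injective n₁ n₂)).measureReal_preimage hs.nullMeasurableSet

/-- Markov: each true null is selected with probability at most m^(γ-1), and each false one counts
at most once. -/
lemma dataLaw_real_card_selected_ge_le (hm : 0 < m) (hn : 2 ≤ n₁) (hγ : γ ≤ 1) (hK : 0 < K) :
    (dataLaw (n₁ + n₂) μ).real {x | K ≤ ((selected γ x).card : ℝ)} ≤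
      ((m : ℝ) ^ γ + numFalse μ) / K := by
  obtain ⟨hp, hp'⟩ := selectionLevel_mem hm hγ
  have hm' : (0 : ℝ) < m := by exact_mod_cast hm
  set q := tQuantile (n₁ - 1) (1 - (m : ℝ) ^ (γ - 1) / 2) with hq
  have hA : MeasurableSet {w : Fin (n₁ + n₂) → ℝ |
      q < |tStat fun j : Fin n₁ => w (Fin.castAdd n₂ j)|} :=
    measurableSet_lt measurable_const (by fun_prop)
  refine (pi_real_card_ge_le (fun i => Measure.pi fun _ : Fin (n₁ + n₂) => gaussianReal (μ i) 1)
    hA hK).trans ?_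
  gcongr
  have hle : ∀ i, (Measure.pi fun _ : Fin (n₁ + n₂) => gaussianReal (μ i) 1).real
      {w | q < |tStat fun j : Fin n₁ => w (Fin.castAdd n₂ j)|} ≤
      (m : ℝ) ^ (γ - 1) + if μ i ≠ 0 then 1 else 0 := by
    intro i
    split_ifs with h
    · exact measureReal_le_one.trans (le_add_of_nonneg_left (by positivity))
    · rw [pi_real_selection, not_not.1 h]
      exact (pi_gaussianReal_real_tStat_gt_tQuantile hn hp hp').2.trans_eq (by ring)
  refine (Finset.sum_le_sum fun i _ => hle i).trans_eq ?_
  rw [Finset.sum_add_distrib, Finset.sum_const, Finset.card_univ, Fintype.card_fin, nsmul_eq_mul,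
    Finset.sum_boole, numFalse_eq_card, Real.rpow_sub_one hm'.ne', mul_div_cancel₀ _ hm'.ne']

/-- At least m/2 true nulls, each selected with probability at least m^(γ-1)/2, give an expected
count of at least m^γ/4. -/
lemma dataLaw_real_card_selected_le_le (hm : 0 < m) (hn : 2 ≤ n₁) (hγ : γ ≤ 1)
    (hfalse : (numFalse μ : ℝ) ≤ m / 2) :
    (dataLaw (n₁ + n₂) μ).real {x | ((selected γ x).card : ℝ) ≤ (m : ℝ) ^ γ / 4 / 2} ≤
      4 / ((m : ℝ) ^ γ / 4) := by
  obtain ⟨hp, hp'⟩ := selectionLevel_mem hm hγ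
  have hm' : (0 : ℝ) < m := by exact_mod_cast hm
  set q := tQuantile (n₁ - 1) (1 - (m : ℝ) ^ (γ - 1) / 2) with hq
  have hA : MeasurableSet {w : Fin (n₁ + n₂) → ℝ |
      q < |tStat fun j : Fin n₁ => w (Fin.castAdd n₂ j)|} :=
    measurableSet_lt measurable_const (by fun_prop)
  refine pi_real_card_le_le (fun i => Measure.pi fun _ : Fin (n₁ + n₂) => gaussianReal (μ i) 1)
    hA (Finset.univ.filter fun i => μ i = 0) (by positivity) ?_
  have hle : ∀ i ∈ Finset.univ.filter fun i => μ i = 0, (m : ℝ) ^ (γ - 1) / 2 ≤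
      (Measure.pi fun _ : Fin (n₁ + n₂) => gaussianReal (μ i) 1).real
      {w | q < |tStat fun j : Fin n₁ => w (Fin.castAdd n₂ j)|} := by
    intro i hi
    rw [pi_real_selection, (Finset.mem_filter.1 hi).2]
    exact (pi_gaussianReal_real_tStat_gt_tQuantile hn hp hp').1.trans_eq' (by ring)
  have hcard : (m : ℝ) / 2 ≤ (Finset.univ.filter fun i => μ i = 0).card := by
    have h := Finset.card_filter_add_card_filter_not (s := Finset.univ) (fun i => μ i = 0)
    rw [Finset.card_univ, Fintype.card_fin] at h
    have h' : ((Finset.univ.filter fun i => μ i = 0).card : ℝ) + numFalse μ = m := by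
      rw [numFalse_eq_card]
      exact_mod_cast h
    linarith
  refine le_trans ?_ (Finset.card_nsmul_le_sum _ _ _ hle)
  rw [nsmul_eq_mul]
  refine le_trans (le_of_eq ?_) (mul_le_mul_of_nonneg_right hcard (by positivity))
  rw [Real.rpow_sub_one hm'.ne']
  field_simp
  norm_num

end Selection

section SelectionAsymptotics

variable {n₁ n₂ : ℕ → ℕ} {μ : ∀ m : ℕ, Fin m → ℝ} {γ ε θ : ℝ}

lemma tendsto_real_card_selected_ge (hn₁ : Tendsto n₁ atTop atTop) (hγ : γ ≤ 1)
    (hsparse : (fun m : ℕ => (numFalse (μ m) : ℝ)) =O[atTop] fun m : ℕ => (m : ℝ) ^ (1 - ε))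
    (hγθ : γ < θ) (hεθ : 1 - ε < θ) :
    Tendsto (fun m => (dataLaw (n₁ m + n₂ m) (μ m)).real
      {x | (m : ℝ) ^ θ ≤ ((selected γ x).card : ℝ)}) atTop (𝓝 0) := by
  obtain ⟨C, hC⟩ := hsparse.bound
  have hlim : Tendsto (fun m : ℕ => (m : ℝ) ^ (γ - θ) + C * (m : ℝ) ^ (1 - ε - θ)) atTop (𝓝 0) := by
    have h : ∀ s : ℝ, s < 0 → Tendsto (fun m : ℕ => (m : ℝ) ^ s) atTop (𝓝 0) := fun s hs => by
      have := (tendsto_rpow_neg_atTop (neg_pos.2 hs)).comp tendsto_natCast_atTop_atTop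
      simpa [Function.comp_def] using this
    simpa using (h (γ - θ) (by linarith)).add ((h (1 - ε - θ) (by linarith)).const_mul C)
  refine squeeze_zero' (Eventually.of_forall fun m => measureReal_nonneg) ?_ hlim
  filter_upwards [eventually_gt_atTop 0, hn₁.eventually_ge_atTop 2, hC] with m hm hn hCm
  have hm' : (0 : ℝ) < m := by exact_mod_cast hm
  refine (dataLaw_real_card_selected_ge_le (μ m) hm hn hγ (by positivity)).trans ?_
  rw [Real.norm_of_nonneg (by positivity), Real.norm_of_nonneg (by positivity)] at hCm
  rw [Real.rpow_sub hm' γ, Real.rpow_sub hm' (1 - ε), add_div, ← mul_div_assoc]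
  gcongr

lemma tendsto_real_card_selected_lt (hn₁ : Tendsto n₁ atTop atTop) (hγ : γ ≤ 1) (hγ0 : 0 < γ)
    (hsparse : (fun m : ℕ => (numFalse (μ m) : ℝ)) =O[atTop] fun m : ℕ => (m : ℝ) ^ (1 - ε))
    (hε : 0 < ε) (hγθ : θ < γ) :
    Tendsto (fun m => (dataLaw (n₁ m + n₂ m) (μ m)).real
      {x | ((selected γ x).card : ℝ) < (m : ℝ) ^ θ}) atTop (𝓝 0) := by
  obtain ⟨C, hC⟩ := hsparse.bound
  have hpow : ∀ s : ℝ, 0 < s → Tendsto (fun m : ℕ => (m : ℝ) ^ s) atTop atTop := fun s hs =>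
    (tendsto_rpow_atTop hs).comp tendsto_natCast_atTop_atTop
  have hlim : Tendsto (fun m : ℕ => 4 / ((m : ℝ) ^ γ / 4)) atTop (𝓝 0) :=
    ((hpow γ hγ0).atTop_div_const (by norm_num)).const_div_atTop 4
  refine squeeze_zero' (Eventually.of_forall fun m => measureReal_nonneg) ?_ hlim
  -- The bound m^ε ≥ 2C makes at least half the hypotheses true; m^(γ-θ) ≥ 8 gives m^θ ≤ m^γ/8.
  filter_upwards [eventually_gt_atTop 0, hn₁.eventually_ge_atTop 2, hC,
    (hpow ε hε).eventually_ge_atTop (2 * C), (hpow (γ - θ) (by linarith)).eventually_ge_atTop 8]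
    with m hm hn hCm hεm hθm
  have hm' : (0 : ℝ) < m := by exact_mod_cast hm
  have hfalse : (numFalse (μ m) : ℝ) ≤ m / 2 := by
    rw [Real.norm_of_nonneg (by positivity), Real.norm_of_nonneg (by positivity),
      Real.rpow_sub hm', Real.rpow_one] at hCm
    refine hCm.trans ?_
    have : 0 < (m : ℝ) ^ ε := by positivity
    rw [← mul_div_assoc, div_le_div_iff₀ this two_pos]
    nlinarith
  refine (measureReal_mono fun x hx => ?_).trans
    (dataLaw_real_card_selected_le_le (μ m) hm hn hγ hfalse)
  simp only [Set.mem_ofPred_eq] at hx ⊢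
  refine hx.le.trans ?_
  rw [Real.rpow_sub hm', le_div_iff₀ (by positivity)] at hθm
  linarith

end SelectionAsymptotics

/-! ### Union bounds for the rejection probability -/

section Bounds

variable {m n₁ n₂ : ℕ} {α γ μ₁ y₁ y₂ K : ℝ} {μ : Fin m → ℝ}

lemma rejectionProb_le_stage_one (hm : 0 < m) (hμ : μ ⟨0, hm⟩ = μ₁)
    (hq : y₁ ≤ tQuantile (n₁ - 1) (1 - (m : ℝ) ^ (γ - 1) / 2)) :
    rejectionProb α γ n₁ n₂ μ ≤
      (Measure.pi fun _ : Fin n₁ => gaussianReal μ₁ 1).real {x | y₁ < |tStat x|} := by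
  subst hμ
  have h := dataLaw_real_tStat₁ (n₁ := n₁) (n₂ := n₂) μ ⟨0, hm⟩ (s := {t | y₁ < |t|})
    (measurableSet_lt measurable_const (by fun_prop))
  refine (measureReal_mono ?_).trans_eq h
  rintro x ⟨hm, hx⟩
  exact hq.trans_lt (Finset.mem_filter.1 (Finset.mem_filter.1 hx).1).2

lemma rejectionProb_le_stage_two (hα : 0 < α) (hm : 0 < m) (hμ : μ ⟨0, hm⟩ = μ₁) (hK : 0 < K)
    (hq : ∀ p < 1, 1 - p ≤ α / (2 * K) → y₂ ≤ tQuantile (n₂ - 1) p) :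
    rejectionProb α γ n₁ n₂ μ ≤
      (dataLaw (n₁ + n₂) μ).real {x | ((selected γ x).card : ℝ) < K} +
      (Measure.pi fun _ : Fin n₂ => gaussianReal μ₁ 1).real {x | y₂ < |tStat x|} := by
  subst hμ
  have h := dataLaw_real_tStat₂ (n₁ := n₁) (n₂ := n₂) μ ⟨0, hm⟩ (s := {t | y₂ < |t|})
    (measurableSet_lt measurable_const (by fun_prop))
  refine (measureReal_mono ?_).trans ((measureReal_union_le _ _).trans_eq (congrArg _ h))
  rintro x ⟨hm, hx⟩
  rcases lt_or_ge ((selected γ x).card : ℝ) K with hc | hc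
  · exact Or.inl hc
  · refine Or.inr ((hq _ ?_ ?_).trans_lt (Finset.mem_filter.1 hx).2)
    · have : 0 < α / (2 * ((selected γ x).card : ℝ)) := by
        have := hK.trans_le hc
        positivity
      linarith
    · rw [sub_sub_cancel]
      gcongr

lemma one_sub_le_rejectionProb (hα : 0 < α) (hα' : α < 1) (hm : 0 < m) (hμ : μ ⟨0, hm⟩ = μ₁)
    (hq₁ : tQuantile (n₁ - 1) (1 - (m : ℝ) ^ (γ - 1) / 2) ≤ y₁)
    (hq₂ : ∀ p, 0 < p → α / (2 * K) ≤ 1 - p → tQuantile (n₂ - 1) p ≤ y₂) :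
    1 - ((Measure.pi fun _ : Fin n₁ => gaussianReal μ₁ 1).real {x | |tStat x| ≤ y₁} +
      (Measure.pi fun _ : Fin n₂ => gaussianReal μ₁ 1).real {x | |tStat x| ≤ y₂} +
      (dataLaw (n₁ + n₂) μ).real {x | K ≤ ((selected γ x).card : ℝ)}) ≤
      rejectionProb α γ n₁ n₂ μ := by
  subst hμ
  set P := dataLaw (n₁ + n₂) μ
  have h₁ : P.real {x | |tStat₁ x ⟨0, hm⟩| ≤ y₁} = _ :=
    dataLaw_real_tStat₁ (n₁ := n₁) (n₂ := n₂) μ ⟨0, hm⟩ (s := {t | |t| ≤ y₁})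
      (measurableSet_le (by fun_prop) measurable_const)
  have h₂ : P.real {x | |tStat₂ x ⟨0, hm⟩| ≤ y₂} = _ :=
    dataLaw_real_tStat₂ (n₁ := n₁) (n₂ := n₂) μ ⟨0, hm⟩ (s := {t | |t| ≤ y₂})
      (measurableSet_le (by fun_prop) measurable_const)
  simp only [Set.mem_ofPred_eq] at h₁ h₂
  rw [← h₁, ← h₂, sub_le_iff_le_add']
  have hcover : (Set.univ : Set (Fin m → Fin (n₁ + n₂) → ℝ)) ⊆
      ({x | |tStat₁ x ⟨0, hm⟩| ≤ y₁} ∪ {x | |tStat₂ x ⟨0, hm⟩| ≤ y₂} ∪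
        {x | K ≤ ((selected γ x).card : ℝ)}) ∪
      {x | ∃ hm : 0 < m, (⟨0, hm⟩ : Fin m) ∈ rejected α γ x} := by
    intro x _
    by_contra hx
    simp only [Set.mem_union, Set.mem_ofPred_eq, not_or, not_le] at hx
    obtain ⟨⟨⟨hx₁, hx₂⟩, hxK⟩, hx⟩ := hx
    have hsel : (⟨0, hm⟩ : Fin m) ∈ selected γ x :=
      Finset.mem_filter.2 ⟨Finset.mem_univ _, hq₁.trans_lt hx₁⟩
    -- Selection of the first hypothesis forces |Ŝ| ≥ 1, so the stage-two level is at least 1 - α/2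
    -- > 0.
    have hcard : (1 : ℝ) ≤ ((selected γ x).card : ℝ) := by
      exact_mod_cast Finset.card_pos.2 ⟨_, hsel⟩
    refine hx ⟨hm, Finset.mem_filter.2 ⟨hsel, (hq₂ _ ?_ ?_).trans_lt hx₂⟩⟩
    · rw [sub_pos, div_lt_one (by positivity)]
      linarith
    · rw [sub_sub_cancel]
      gcongr
  calc (1 : ℝ) = P.real Set.univ := probReal_univ.symm
    _ ≤ _ := measureReal_mono hcover
    _ ≤ _ := (measureReal_union_le _ _).trans (add_le_add_left ((measureReal_union_le _ _).trans
        (add_le_add_left (measureReal_union_le _ _) _)) _)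

end Bounds

/-! ### Sample sizes -/

lemma tendsto_log_div_pred {N κ : ℕ → ℕ} {d ρ : ℝ} (hρ : 0 < ρ)
    (hN : Tendsto (fun m : ℕ => Real.log m / (N m : ℝ)) atTop (𝓝 d))
    (hκ : Tendsto (fun m => (κ m : ℝ) / (N m : ℝ)) atTop (𝓝 ρ)) :
    Tendsto κ atTop atTop ∧
      Tendsto (fun m : ℕ => Real.log m / ((κ m - 1 : ℕ) : ℝ)) atTop (𝓝 (d / ρ)) := by
  have hlog : Tendsto (fun m : ℕ => Real.log m) atTop atTop :=
    Real.tendsto_log_atTop.comp tendsto_natCast_atTop_atTop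
  -- At N = 0 the ratio κ/N would be 0 by convention, contradicting its positive limit.
  have hN0 : ∀ᶠ m in atTop, (0 : ℝ) < N m := by
    filter_upwards [hκ.eventually_const_lt hρ] with m hm
    refine lt_of_le_of_ne (Nat.cast_nonneg _) fun h => ?_
    rw [← h, div_zero] at hm
    exact lt_irrefl _ hm
  have hNtop : Tendsto (fun m => (N m : ℝ)) atTop atTop := by
    have h1 : Tendsto (fun m : ℕ => Real.log m / (|d| + 1)) atTop atTop :=
      hlog.atTop_div_const (by positivity)
    refine tendsto_atTop_mono' _ ?_ h1
    filter_upwards [hN0, hN.eventually_lt_const (show d < |d| + 1 by linarith [le_abs_self d])]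
      with m hm hlt
    rw [div_lt_iff₀ hm] at hlt
    rw [div_le_iff₀ (by positivity)]
    linarith
  have hκtop : Tendsto (fun m => (κ m : ℝ)) atTop atTop := by
    refine (hκ.pos_mul_atTop hρ hNtop).congr' ?_
    filter_upwards [hN0] with m hm
    exact div_mul_cancel₀ _ hm.ne'
  refine ⟨tendsto_natCast_atTop_iff.1 hκtop, ?_⟩
  have h1 : Tendsto (fun m => ((κ m : ℝ) - 1) / N m) atTop (𝓝 ρ) := by
    simpa [sub_div] using hκ.sub (hNtop.const_div_atTop 1)
  refine (hN.div h1 hρ.ne').congr' ?_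
  filter_upwards [hN0, hκtop.eventually_ge_atTop 1] with m hm hm1
  rw [Nat.cast_pred (by exact_mod_cast hm1)]
  simp only [Pi.div_apply]
  field_simp

lemma tendsto_affine_log_div {κ : ℕ → ℕ} {ℓ : ℝ} (hκ : Tendsto κ atTop atTop)
    (h : Tendsto (fun m : ℕ => Real.log m / (κ m : ℝ)) atTop (𝓝 ℓ)) (θ c : ℝ) :
    Tendsto (fun m : ℕ => (θ * Real.log m + c) / (κ m : ℝ)) atTop (𝓝 (θ * ℓ)) := by
  have hκ' : Tendsto (fun m => (κ m : ℝ)) atTop atTop := tendsto_natCast_atTop_atTop.comp hκ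
  simpa [add_div, mul_div_assoc] using (h.const_mul θ).add (hκ'.const_div_atTop c)

lemma exp_neg_affine_log {m : ℕ} (hm : 0 < m) (θ : ℝ) {c : ℝ} (hc : 0 < c) :
    Real.exp (-(θ * Real.log m + Real.log c)) = ((m : ℝ) ^ θ)⁻¹ * c⁻¹ := by
  have hm' : (0 : ℝ) < m := by exact_mod_cast hm
  rw [neg_add, Real.exp_add, Real.exp_neg, Real.exp_neg, Real.exp_log hc, mul_comm θ,
    ← Real.rpow_def_of_pos hm']

lemma exp_sub_one_lt_sq_iff {c y : ℝ} :
    Real.exp (2 * c) - 1 < y ^ 2 ↔ c < 1 / 2 * Real.log (1 + y ^ 2) := by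
  rw [sub_lt_iff_lt_add', ← Real.lt_log_iff_exp_lt (by positivity)]
  constructor <;> intro h <;> linarith

lemma sq_lt_exp_sub_one_iff {c y : ℝ} :
    y ^ 2 < Real.exp (2 * c) - 1 ↔ 1 / 2 * Real.log (1 + y ^ 2) < c := by
  rw [lt_sub_iff_add_lt', ← Real.log_lt_iff_lt_exp (by positivity)]
  constructor <;> intro h <;> linarith

end SplitSample

theorem theorem7p2
    (α γ ε d r : ℝ) (hα : 0 < α) (hα' : α < 1) (hγ : 0 < γ) (hγ' : γ ≤ 1)
    (hε : 0 < ε) (hε' : ε ≤ 1) (hd : 0 ≤ d) (hr : 0 < r) (hr' : r < 1)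
    (n₁ n₂ : ℕ → ℕ)
    (hA : Tendsto (fun m : ℕ => Real.log m / ((n₁ m + n₂ m : ℕ) : ℝ)) atTop (𝓝 d))
    (hsplit : Tendsto (fun m : ℕ => (n₁ m : ℝ) / ((n₁ m + n₂ m : ℕ) : ℝ)) atTop (𝓝 r))
    (μ : ∀ m : ℕ, Fin m → ℝ)
    (hsparse : (fun m : ℕ => (SplitSample.numFalse (μ m) : ℝ)) =Θ[atTop]
      fun m : ℕ => (m : ℝ) ^ (1 - ε))
    (μ₁ : ℝ) (hμ₁ : ∀ (m : ℕ) (hm : 0 < m), μ m ⟨0, hm⟩ = μ₁) :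
    ((0 < d → 1 ≤ ε + γ) →
      max (Real.exp (2 * (1 - γ) * d / r)) (Real.exp (2 * γ * d / (1 - r))) - 1 < μ₁ ^ 2 →
      Tendsto (fun m : ℕ => SplitSample.rejectionProb α γ (n₁ m) (n₂ m) (μ m)) atTop (𝓝 1)) ∧
    (μ₁ ^ 2 < max (Real.exp (2 * (1 - γ) * d / r)) (Real.exp (2 * γ * d / (1 - r))) - 1 →
      Tendsto (fun m : ℕ => SplitSample.rejectionProb α γ (n₁ m) (n₂ m) (μ m)) atTop (𝓝 0)) := by
  obtain ⟨hn₁, hlog₁⟩ := SplitSample.tendsto_log_div_pred hr hA hsplit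
  have hsplit₂ : Tendsto (fun m : ℕ => (n₂ m : ℝ) / ((n₁ m + n₂ m : ℕ) : ℝ)) atTop (𝓝 (1 - r)) := by
    refine (hsplit.const_sub 1).congr' ?_
    filter_upwards [hn₁.eventually_gt_atTop 0] with m hm
    have : (0 : ℝ) < ((n₁ m + n₂ m : ℕ) : ℝ) := by exact_mod_cast Nat.add_pos_left hm _
    rw [one_sub_div this.ne']
    push_cast
    ring
  obtain ⟨hn₂, hlog₂⟩ := SplitSample.tendsto_log_div_pred (sub_pos.2 hr') hA hsplit₂
  have hκ₁ : Tendsto (fun m => n₁ m - 1) atTop atTop := (tendsto_sub_atTop_nat 1).comp hn₁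
  have hκ₂ : Tendsto (fun m => n₂ m - 1) atTop atTop := (tendsto_sub_atTop_nat 1).comp hn₂
  have hL₁ := SplitSample.tendsto_affine_log_div hκ₁ hlog₁ (1 - γ) (Real.log 2)
  have hL₂ := fun θ => SplitSample.tendsto_affine_log_div hκ₂ hlog₂ θ (Real.log (2 / α))
  have hexp₁ : ∀ m : ℕ, 0 < m → Real.exp (-((1 - γ) * Real.log m + Real.log 2)) =
      (m : ℝ) ^ (γ - 1) / 2 := fun m hm => by
    rw [SplitSample.exp_neg_affine_log hm _ two_pos, ← Real.rpow_neg (Nat.cast_nonneg m), neg_sub]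
    rfl
  have hexp₂ : ∀ (θ : ℝ) (m : ℕ), 0 < m → Real.exp (-(θ * Real.log m + Real.log (2 / α))) =
      α / (2 * (m : ℝ) ^ θ) := fun θ m hm => by
    have hm' : (0 : ℝ) < m := by exact_mod_cast hm
    rw [SplitSample.exp_neg_affine_log hm _ (by positivity)]
    field_simp
  rw [show 2 * (1 - γ) * d / r = 2 * ((1 - γ) * (d / r)) by ring,
    show 2 * γ * d / (1 - r) = 2 * (γ * (d / (1 - r))) by ring]
  have hd₂ : 0 ≤ d / (1 - r) := div_nonneg hd (by linarith)
  constructor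
  · intro hεγ hlt
    -- A single cutoff y = √t below |μ₁| serves both stages, since t exceeds both terms of the
    -- maximum.
    obtain ⟨t, ht₁, ht₂⟩ := exists_between hlt
    have ht0 : 0 < t := by
      refine lt_of_le_of_lt ?_ ht₁
      rw [sub_nonneg]
      exact (Real.one_le_exp (by positivity)).trans (le_max_right _ _)
    set y := √t
    have hy : 0 < y := Real.sqrt_pos.2 ht0
    have hy2 : y ^ 2 = t := Real.sq_sqrt ht0.le
    have hyμ : y < |μ₁| := by
      rw [← hy2, sq_lt_sq, abs_of_pos hy] at ht₂
      exact ht₂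
    rw [← max_sub_sub_right, max_lt_iff, ← hy2, SplitSample.exp_sub_one_lt_sq_iff,
      SplitSample.exp_sub_one_lt_sq_iff] at ht₁
    -- If d = 0 the rate vanishes and any large θ will do. If d > 0, θ must be close to γ, and ε + γ
    -- ≥ 1 is what puts it above 1 - ε.
    obtain ⟨θ, hγθ, hεθ, hθ⟩ : ∃ θ, γ < θ ∧ 1 - ε < θ ∧
        θ * (d / (1 - r)) < 1 / 2 * Real.log (1 + y ^ 2) := by
      rcases hd.eq_or_lt with h0 | h0
      · refine ⟨2, by linarith, by linarith, ?_⟩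
        rw [← h0, zero_div, mul_zero]
        have := Real.log_pos (show 1 < 1 + y ^ 2 by rw [hy2]; linarith)
        positivity
      · have hc : ContinuousAt (fun θ : ℝ => θ * (d / (1 - r))) γ := by fun_prop
        obtain ⟨θ, hθ, hθγ⟩ := (((hc.eventually_lt_const ht₁.2).filter_mono
          nhdsWithin_le_nhds).and (self_mem_nhdsWithin (s := Set.Ioi γ))).exists
        have hθγ : γ < θ := hθγ
        exact ⟨θ, hθγ, by linarith [hεγ h0], hθ⟩
    have hlim := (((SplitSample.tendsto_real_tStat_le hn₁ hyμ).add
      (SplitSample.tendsto_real_tStat_le hn₂ hyμ)).add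
      (SplitSample.tendsto_real_card_selected_ge (n₂ := n₂) hn₁ hγ' hsparse.isBigO hγθ
        hεθ)).const_sub 1
    rw [add_zero, add_zero, sub_zero] at hlim
    refine tendsto_of_tendsto_of_tendsto_of_le_of_le' hlim tendsto_const_nhds ?_
      (Eventually.of_forall fun m => measureReal_le_one)
    filter_upwards [eventually_gt_atTop 0,
      SplitSample.eventually_tQuantile_le hκ₁ hL₁ hy.le ht₁.1,
      SplitSample.eventually_tQuantile_le hκ₂ (hL₂ θ) hy.le hθ] with m hm hq₁ hq₂
    refine SplitSample.one_sub_le_rejectionProb hα hα' hm (hμ₁ m hm)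
      (hq₁ _ (SplitSample.selectionLevel_mem hm hγ').1 ?_) fun p hp hpK => hq₂ p hp ?_
    · rw [hexp₁ m hm, sub_sub_cancel]
    · rwa [hexp₂ θ m hm]
  · intro hlt
    rw [← max_sub_sub_right, lt_max_iff] at hlt
    -- Failure at one stage suffices. In the second case θ is taken just below γ, so that |Ŝ| ≥ m^θ
    -- already makes the threshold too high.
    rcases hlt with hlt | hlt
    · obtain ⟨t, ht₁, ht₂⟩ := exists_between hlt
      have ht0 : 0 ≤ t := (sq_nonneg _).trans ht₁.le
      have hyμ : |μ₁| < √t := by rwa [Real.lt_sqrt (abs_nonneg _), sq_abs]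
      rw [← Real.sq_sqrt ht0, SplitSample.sq_lt_exp_sub_one_iff] at ht₂
      refine squeeze_zero' (Eventually.of_forall fun m => measureReal_nonneg) ?_
        (SplitSample.tendsto_real_tStat_gt hn₁ hyμ)
      filter_upwards [eventually_gt_atTop 0,
        SplitSample.eventually_le_tQuantile hκ₁ hL₁ (Real.sqrt_nonneg t) ht₂] with m hm hq
      refine SplitSample.rejectionProb_le_stage_one hm (hμ₁ m hm)
        (hq _ (SplitSample.selectionLevel_mem hm hγ').2 ?_)
      rw [hexp₁ m hm, sub_sub_cancel]
    · obtain ⟨t, ht₁, ht₂⟩ := exists_between hlt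
      have ht0 : 0 ≤ t := (sq_nonneg _).trans ht₁.le
      have hyμ : |μ₁| < √t := by rwa [Real.lt_sqrt (abs_nonneg _), sq_abs]
      rw [← Real.sq_sqrt ht0, SplitSample.sq_lt_exp_sub_one_iff] at ht₂
      have hc : ContinuousAt (fun θ : ℝ => θ * (d / (1 - r))) γ := by fun_prop
      obtain ⟨θ, hθ, hθγ⟩ := (((hc.eventually_const_lt ht₂).filter_mono
        nhdsWithin_le_nhds).and (self_mem_nhdsWithin (s := Set.Iio γ))).exists
      have hlim := (SplitSample.tendsto_real_card_selected_lt (n₂ := n₂) hn₁ hγ' hγ hsparse.isBigO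
        hε hθγ).add (SplitSample.tendsto_real_tStat_gt hn₂ hyμ)
      rw [add_zero] at hlim
      refine squeeze_zero' (Eventually.of_forall fun m => measureReal_nonneg) ?_ hlim
      filter_upwards [eventually_gt_atTop 0,
        SplitSample.eventually_le_tQuantile hκ₂ (hL₂ θ) (Real.sqrt_nonneg t) hθ] with m hm hq
      have hm' : (0 : ℝ) < m := by exact_mod_cast hm
      refine SplitSample.rejectionProb_le_stage_two hα hm (hμ₁ m hm) (by positivity)
        fun p hp hpK => hq p hp ?_
      rwa [hexp₂ θ m hm]
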